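/- Let $(\Omega,\mu)$ be an atomless standard probability space. All sets below are measurable. A graphon is a symmetric measurable function $W:\Omega^2\to[0,1]$. For $n\in\mathbb N$, the random graph $\mathbb G(n,W)$ on the vertex set $\{1,\dots,n\}$ is generated by first sampling independent points $X_1,\dots,X_n$ from $\Omega$ with distribution $\mu$ and then, conditionally on $X_1,\dots,X_n$, joining $i$ and $j$ by an edge with probability $W(X_i,X_j)$, independently for all pairs $1\le i<j\le n$. The degree of $x\in\Omega$ is $\deg_W(x)=\int_\Omega W(x,y)\,d\mu(y)$, and $D_W(\alpha)=\{x\in\Omega:\deg_W(x)\le\alpha\}$. Let $W:\Omega^2\to[0,1]$ be a graphon, and suppose that at least one of the following conditions holds: (i) $W$ is not connected, i.e. there is a partition $\Omega=S\sqcup T$ with $\mu(S),\mu(T)>0$ and $\int_{S\times T}W\,d\mu^2=0$; (ii) $\lim_{\alpha\searrow0}\mu(D_W(\alpha))/\alpha=\infty$; (iii) $W$ has a narrow peninsula, i.e. there are a number $a\in(0,\tfrac12]$ and disjoint sets $A,B\subset\Omega$ such that $\mu(A)>a$, $\mu(B)=1-2a$, and $W$ is zero almost everywhere on $A\times(A\cup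 B)$; (iv) there is a partition $\Omega=S\sqcup T$ with $\mu(S)=\mu(T)=\tfrac12$ such that $W$ is zero almost everywhere on $(S\times S)\cup(T\times T)$. Then $\mathbb G(n,W)$ is asymptotically almost never Hamiltonian, that is, $$\lim_{n\to\infty}\mathbb P[\mathbb G(n,W)\text{ has a Hamilton cycle}]=0 .$$ -/

import Mathlib

open MeasureTheory ProbabilityTheory Filter Topology unitInterval

/-- A graphon on a measurable space `Ω`: a symmetric, (jointly) measurable function
`Ω² → [0,1]`. -/
structure Graphon (Ω : Type*) [MeasurableSpace Ω] where
  /-- The underlying function `Ω² → [0,1]`, in curried form. -/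
  toFun : Ω → Ω → I
  measurable' : Measurable (Function.uncurry toFun)
  symm' : ∀ x y, toFun x y = toFun y x

namespace Graphon

variable {Ω : Type*} [MeasurableSpace Ω]

instance : CoeFun (Graphon Ω) fun _ => Ω → Ω → I := ⟨Graphon.toFun⟩

/-- `W` is connected (with respect to `μ`): whenever `Ω = S ⊔ T` with `μ S, μ T > 0`, we have
`∫_{S × T} W > 0`. -/
def Connected (W : Graphon Ω) (μ : Measure Ω) : Prop :=
  ∀ S T : Set Ω, MeasurableSet S → MeasurableSet T → Disjoint S T → S ∪ T = Set.univ →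
    0 < μ S → 0 < μ T → 0 < ∫ p in S ×ˢ T, (W p.1 p.2 : ℝ) ∂(μ.prod μ)

/-- The degree `deg_W(x) = ∫ W(x,y) dμ(y)`. -/
noncomputable def degree (W : Graphon Ω) (μ : Measure Ω) (x : Ω) : ℝ :=
  ∫ y, (W x y : ℝ) ∂μ

/-- The set `D_W(α)` of the points of degree at most `α`. -/
def lowDegree (W : Graphon Ω) (μ : Measure Ω) (α : ℝ) : Set Ω :=
  {x | W.degree μ x ≤ α}

/-- `W` has a narrow peninsula: for some `a ∈ (0, 1/2]` there are disjoint sets `A, B` with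
`μ A > a`, `μ B = 1 - 2a`, and `W` is zero (up to a null set) on `A × (A ∪ B)`. -/
def HasNarrowPeninsula (W : Graphon Ω) (μ : Measure Ω) : Prop :=
  ∃ a : ℝ, 0 < a ∧ a ≤ 1 / 2 ∧ ∃ A B : Set Ω, MeasurableSet A ∧ MeasurableSet B ∧ Disjoint A B ∧
    a < μ.real A ∧ μ.real B = 1 - 2 * a ∧
    ∀ᵐ p ∂(μ.prod μ), p ∈ A ×ˢ (A ∪ B) → W p.1 p.2 = 0

/-- `W` vanishes inside both parts of a halving: there is a partition `Ω = S ⊔ T` with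
`μ S = μ T = 1/2` such that `W` is zero almost everywhere on `(S × S) ∪ (T × T)`. -/
def IsHalvedBipartite (W : Graphon Ω) (μ : Measure Ω) : Prop :=
  ∃ S T : Set Ω, MeasurableSet S ∧ MeasurableSet T ∧ Disjoint S T ∧ S ∪ T = Set.univ ∧
    μ.real S = 1 / 2 ∧ μ.real T = 1 / 2 ∧
    ∀ᵐ p ∂(μ.prod μ), p ∈ (S ×ˢ S) ∪ (T ×ˢ T) → W p.1 p.2 = 0

/-- The pairs `1 ≤ i < j ≤ n` of vertices, i.e. the potential edges of a graph on `n` vertices. -/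
abbrev Pairs (n : ℕ) : Type := {e : Fin n × Fin n // e.1 < e.2}

/-- The graph on `n` vertices in which a pair `i < j` is joined exactly when `s (i, j)` holds. -/
def graphOfPairs {n : ℕ} (s : Pairs n → Prop) : SimpleGraph (Fin n) :=
  SimpleGraph.fromRel fun i j => ∃ h : i < j, s ⟨(i, j), h⟩

/-- The indicators of the edges, given the vertex types `x`: independent over all pairs `i < j`,
and the indicator of `{i, j}` is true with probability `W (x i) (x j)`. -/
noncomputable def edgeIndicatorLaw (W : Graphon Ω) {n : ℕ} (x : Fin n → Ω) :
    Measure (Pairs n → Prop) :=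
  Measure.pi fun e : Pairs n => bernoulliMeasure True False (W (x e.1.1) (x e.1.2))

/-- The conditional law of the random graph, given the vertex types `x`. -/
noncomputable def edgeLaw (W : Graphon Ω) {n : ℕ} (x : Fin n → Ω) :
    Measure (SimpleGraph (Fin n)) :=
  (W.edgeIndicatorLaw x).map graphOfPairs

/-- The law of the random graph `𝔾(n, W)` on `n` vertices: first sample independent vertex types
`x 0, …, x (n-1)` from `μ`, then sample the edges according to `W.edgeLaw x`. -/
noncomputable def randomGraph (W : Graphon Ω) (μ : Measure Ω) (n : ℕ) :
    Measure (SimpleGraph (Fin n)) :=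
  (Measure.pi fun _ : Fin n => μ).bind W.edgeLaw

/-! The following facts show that `randomGraph` involves no junk values. -/

instance (W : Graphon Ω) {n : ℕ} (x : Fin n → Ω) : IsProbabilityMeasure (W.edgeIndicatorLaw x) := by
  have : ∀ e : Pairs n,
      IsProbabilityMeasure (bernoulliMeasure True False (W (x e.1.1) (x e.1.2))) := inferInstance
  unfold edgeIndicatorLaw
  infer_instance

theorem measurable_graphOfPairs {n : ℕ} :
    Measurable (graphOfPairs : (Pairs n → Prop) → SimpleGraph (Fin n)) :=
  measurable_of_finite _

instance (W : Graphon Ω) {n : ℕ} (x : Fin n → Ω) : IsProbabilityMeasure (W.edgeLaw x) :=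
  Measure.isProbabilityMeasure_map measurable_graphOfPairs.aemeasurable

theorem measurable_edgeIndicatorLaw (W : Graphon Ω) (n : ℕ) :
    Measurable (W.edgeIndicatorLaw : (Fin n → Ω) → Measure (Pairs n → Prop)) := by
  classical
  refine Measurable.measure_of_isPiSystem_of_isProbabilityMeasure generateFrom_pi.symm
    isPiSystem_pi ?_
  rintro _ ⟨t, -, rfl⟩
  simp only [edgeIndicatorLaw, Measure.pi_pi]
  refine Finset.measurable_prod _ fun e _ => ?_
  have hW : Measurable fun x : Fin n → Ω => W (x e.1.1) (x e.1.2) :=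
    W.measurable'.comp (Measurable.prodMk (measurable_pi_apply _) (measurable_pi_apply _))
  have h1 : Measurable fun x : Fin n → Ω => ((toNNReal (W (x e.1.1) (x e.1.2)) : NNReal) : ENNReal) :=
    measurable_coe_nnreal_ennreal.comp
      ((continuous_subtype_val.measurable.comp hW).subtype_mk)
  have h2 : Measurable fun x : Fin n → Ω =>
      ((toNNReal (σ (W (x e.1.1) (x e.1.2))) : NNReal) : ENNReal) :=
    measurable_coe_nnreal_ennreal.comp
      ((continuous_subtype_val.measurable.comp (continuous_symm.measurable.comp hW)).subtype_mk)
  simp only [bernoulliMeasure_apply _ (MeasurableSet.of_discrete (s := t e))]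
  split_ifs
  exacts [measurable_const, h1, h2, measurable_const]

theorem measurable_edgeLaw (W : Graphon Ω) (n : ℕ) :
    Measurable (W.edgeLaw : (Fin n → Ω) → Measure (SimpleGraph (Fin n))) :=
  (Measure.measurable_map _ measurable_graphOfPairs).comp (W.measurable_edgeIndicatorLaw n)

theorem randomGraph_apply (W : Graphon Ω) (μ : Measure Ω) (n : ℕ)
    {s : Set (SimpleGraph (Fin n))} (hs : MeasurableSet s) :
    W.randomGraph μ n s = ∫⁻ x, W.edgeLaw x s ∂(Measure.pi fun _ : Fin n => μ) :=
  Measure.bind_apply hs (W.measurable_edgeLaw n).aemeasurable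

/-- Every set of graphs on `n` vertices is an event. -/
theorem measurableSet_graphs {n : ℕ} (s : Set (SimpleGraph (Fin n))) : MeasurableSet s := by
  have : MeasurableSingletonClass (SimpleGraph (Fin n)) := ⟨fun G => by
    have : ({G} : Set (SimpleGraph (Fin n))) = ⋂ u, ⋂ v, {H | H.Adj u v ↔ G.Adj u v} := by
      ext H; simp [SimpleGraph.ext_iff, funext_iff]
    rw [this]
    refine .iInter fun u => .iInter fun v => ?_
    have h : Measurable fun H : SimpleGraph (Fin n) => H.Adj u v := by fun_prop
    exact h (MeasurableSet.of_discrete (s := {p | p ↔ G.Adj u v}))⟩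
  exact s.toFinite.measurableSet

instance (W : Graphon Ω) (μ : Measure Ω) [IsProbabilityMeasure μ] (n : ℕ) :
    IsProbabilityMeasure (W.randomGraph μ n) :=
  ⟨by simp [randomGraph_apply]⟩

end Graphon

/-! Each condition yields an obstruction to a Hamilton cycle that is present with probability
tending to one. (i) Almost surely no edge joins an `S`-type to a `T`-type, so the graph is
disconnected once both types are sampled. (iii) Vertices with type in `A` have all their neighbours
in `C = (A ∪ B)ᶜ`. Following a Hamilton cycle injects them into the `C`-vertices (`card_filter_le`).
Since `μ C = 2a - μ A < μ A`, a Chernoff bound makes such a count exponentially unlikely. (iv) The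
same injection, used in both directions, forces exactly half of the types into `S`. This has
probability `n.choose (n / 2) / 2 ^ n` for even `n` and is impossible for odd `n`. (ii) With `α = c
/ n`, the number of types in `D = W.lowDegree μ α` is at least half its mean `n * μ D → ∞` with high
probability. A Hamilton cycle gives each of these vertices a neighbour, while the expected number of
ordered edges leaving them is at most `n² * μ D * α`. Averaging over these vertices bounds the
probability by `2c + o(1)`, for any `c > 0`. Only the marginal edge probabilities enter, so no
second moment is needed. -/

/-! ### Necessary conditions for a Hamilton cycle. -/

/-- In a Hamiltonian graph, an independent set whose neighbours all lie in `C` has at most as many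
vertices as `C`. -/
theorem SimpleGraph.IsHamiltonian.card_filter_le {V : Type*} [Fintype V] [DecidableEq V]
    {G : SimpleGraph V} (hG : G.IsHamiltonian) (hV : Fintype.card V ≠ 1) (A C : V → Prop)
    [DecidablePred A] [DecidablePred C] (h : ∀ u v, G.Adj u v → A u → C v) :
    (Finset.univ.filter A).card ≤ (Finset.univ.filter C).card := by
  obtain ⟨a, p, hp⟩ := hG hV
  -- Without its repeated base point, the cycle lists every vertex exactly once, so cardinalities
  -- become counts along it.
  have key : ∀ P : V → Prop, ∀ [DecidablePred P],
      (Finset.univ.filter P).card = p.support.tail.countP (fun v => decide (P v)) := by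
    intro P _
    have h1 := (SimpleGraph.Walk.isHamiltonianCycle_iff_isCycle_and_support_count_tail_eq_one.1 hp).2
    have hnd : p.support.tail.Nodup := hp.isCycle.support_nodup
    have : p.support.tail.toFinset = Finset.univ := by
      ext v
      simp only [List.mem_toFinset, Finset.mem_univ, iff_true]
      exact List.count_pos_iff.1 (by rw [h1 v]; exact one_pos)
    rw [← this, List.filter_toFinset, List.toFinset_card_of_nodup (hnd.filter _),
      List.countP_eq_length_filter]
  -- Sources of the darts list `dropLast`, targets list `tail`, and these are permutations of each
  -- other; each dart leaving `A` enters `C`.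
  rw [key A, key C, p.tail_support_perm_dropLast_support.countP_eq, ← p.map_fst_darts,
    ← p.map_snd_darts, List.countP_map, List.countP_map]
  refine List.countP_mono_left fun d _ hd => ?_
  simp only [Function.comp_apply, decide_eq_true_eq] at hd ⊢
  exact h _ _ d.adj hd

/-- In a Hamiltonian graph on at least two vertices, no vertex is isolated. -/
theorem SimpleGraph.IsHamiltonian.exists_adj {V : Type*} [Fintype V] [DecidableEq V]
    {G : SimpleGraph V} (hG : G.IsHamiltonian) (hV : 1 < Fintype.card V) (v : V) :
    ∃ w, G.Adj v w := by
  have : Nontrivial V := Fintype.one_lt_card_iff_nontrivial.1 hV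
  exact hG.connected.preconnected.exists_adj_of_nontrivial v

/-! ### Decay of the central binomial probability. -/

/-- The recursion reduces the induction step to `(2m+1)(2m+3) ≤ 4(m+1)²`. The bound says that
`centralBinom m / 4^m` is at most `1/√(2m+1)`. -/
theorem Nat.centralBinom_sq_mul_le (m : ℕ) : m.centralBinom ^ 2 * (2 * m + 1) ≤ 16 ^ m := by
  induction m with
  | zero => simp
  | succ m ih =>
    have h := Nat.succ_mul_centralBinom_succ m
    have h1 : (m + 1) ^ 2 * ((m + 1).centralBinom ^ 2 * (2 * (m + 1) + 1)) ≤
        (m + 1) ^ 2 * 16 ^ (m + 1) := by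
      calc _ = ((m + 1) * (m + 1).centralBinom) ^ 2 * (2 * m + 3) := by ring
        _ = (m.centralBinom ^ 2 * (2 * m + 1)) * (4 * ((2 * m + 1) * (2 * m + 3))) := by
          rw [h]; ring
        _ ≤ 16 ^ m * (16 * (m + 1) ^ 2) := by
          refine Nat.mul_le_mul ih ?_
          nlinarith
        _ = _ := by ring
    exact Nat.le_of_mul_le_mul_left h1 (by positivity)

theorem tendsto_choose_half_div_two_pow :
    Tendsto (fun n : ℕ => if Even n then (n.choose (n / 2) : ℝ) / 2 ^ n else 0) atTop (𝓝 0) := by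
  have hlim : Tendsto (fun n : ℕ => √(1 / ((n : ℝ) + 1))) atTop (𝓝 0) := by
    simpa [Function.comp_def] using
      (Real.continuous_sqrt.tendsto 0).comp tendsto_one_div_add_atTop_nhds_zero_nat
  refine squeeze_zero (fun n => ?_) (fun n => ?_) hlim
  · split_ifs <;> positivity
  · split_ifs with hn
    · obtain ⟨m, rfl⟩ := hn
      apply Real.le_sqrt_of_sq_le
      have h := Nat.centralBinom_sq_mul_le m
      rw [← two_mul, Nat.mul_div_cancel_left _ two_pos, ← Nat.centralBinom_eq_two_mul_choose,
        div_pow, div_le_div_iff₀ (by positivity) (by positivity)]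
      have h' : ((m.centralBinom : ℝ) ^ 2 * (2 * m + 1)) ≤ 16 ^ m := by exact_mod_cast h
      calc _ ≤ (16 : ℝ) ^ m := by push_cast; exact h'
        _ = _ := by rw [one_mul, ← pow_mul, mul_comm (2 * m), ← mul_assoc, pow_mul]; norm_num
    · positivity

namespace Graphon

variable {Ω : Type*} [MeasurableSpace Ω]

/-! ### From the random graph to its vertex types. -/

theorem measurable_coe_uncurry (W : Graphon Ω) : Measurable fun p : Ω × Ω => (W p.1 p.2 : ℝ) :=
  measurable_subtype_coe.comp W.measurable'

/-- The conditional probability of `s` is at most one on `B` and zero off `B`. This turns a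
deterministic obstruction into an estimate on the types alone. -/
theorem randomGraph_real_le (W : Graphon Ω) (μ : Measure Ω) [IsProbabilityMeasure μ] {n : ℕ}
    {s : Set (SimpleGraph (Fin n))} {B : Set (Fin n → Ω)} (hB : MeasurableSet B)
    (h : ∀ᵐ x ∂(Measure.pi fun _ : Fin n => μ), ∀ᵐ G ∂(W.edgeLaw x), G ∈ s → x ∈ B) :
    (W.randomGraph μ n).real s ≤ (Measure.pi fun _ : Fin n => μ).real B := by
  refine ENNReal.toReal_mono (measure_ne_top _ _) ?_
  rw [randomGraph_apply W μ n (measurableSet_graphs s), ← lintegral_indicator_one hB]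
  refine lintegral_mono_ae ?_
  filter_upwards [h] with x hx
  by_cases hxB : x ∈ B
  · simp [hxB, prob_le_one]
  · simp only [hxB, imp_false] at hx
    simpa [hxB, ae_iff] using hx

theorem randomGraph_real_eq_integral (W : Graphon Ω) (μ : Measure Ω) [IsProbabilityMeasure μ]
    {n : ℕ} (s : Set (SimpleGraph (Fin n))) :
    (W.randomGraph μ n).real s = ∫ x, (W.edgeLaw x).real s ∂(Measure.pi fun _ : Fin n => μ) := by
  have hm : Measurable fun x : Fin n → Ω => W.edgeLaw x s :=
    (Measure.measurable_coe (measurableSet_graphs s)).comp (W.measurable_edgeLaw n)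
  simp only [measureReal_def]
  rw [integral_toReal hm.aemeasurable (ae_of_all _ fun x => measure_lt_top _ _),
    randomGraph_apply W μ n (measurableSet_graphs s)]

theorem edgeLaw_real_adj_of_lt (W : Graphon Ω) {n : ℕ} (x : Fin n → Ω) {i j : Fin n}
    (hij : i < j) : (W.edgeLaw x).real {G | G.Adj i j} = W (x i) (x j) := by
  have hpre : graphOfPairs ⁻¹' {G : SimpleGraph (Fin n) | G.Adj i j} =
      (fun s : Pairs n → Prop => s ⟨(i, j), hij⟩) ⁻¹' {True} := by
    ext s
    simp [graphOfPairs, SimpleGraph.fromRel_adj, hij, hij.ne, hij.not_gt]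
  have hp : ∀ e : Pairs n,
      IsProbabilityMeasure (bernoulliMeasure True False (W (x e.1.1) (x e.1.2))) := inferInstance
  rw [edgeLaw, map_measureReal_apply measurable_graphOfPairs (measurableSet_graphs _), hpre,
    edgeIndicatorLaw]
  have := (measurePreserving_eval (fun e : Pairs n =>
    bernoulliMeasure True False (W (x e.1.1) (x e.1.2))) ⟨(i, j), hij⟩).measureReal_preimage
    (s := {True}) (MeasurableSet.of_discrete).nullMeasurableSet
  refine this.trans ?_
  rw [bernoulliMeasure_real_apply_of_mem_of_notMem _ .of_discrete (by simp) (by simp)]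

theorem edgeLaw_real_adj (W : Graphon Ω) {n : ℕ} (x : Fin n → Ω) {i j : Fin n} (hij : i ≠ j) :
    (W.edgeLaw x).real {G | G.Adj i j} = W (x i) (x j) := by
  rcases lt_or_gt_of_ne hij with h | h
  · exact W.edgeLaw_real_adj_of_lt x h
  · simp_rw [SimpleGraph.adj_comm _ i j]
    rw [W.edgeLaw_real_adj_of_lt x h, W.symm']

theorem measurePreserving_eval_pair (μ : Measure Ω) [IsProbabilityMeasure μ] {ι : Type*}
    [Fintype ι] {i j : ι} (hij : i ≠ j) :
    MeasurePreserving (fun x : ι → Ω => (x i, x j)) (Measure.pi fun _ => μ) (μ.prod μ) := by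
  refine ⟨by fun_prop, ?_⟩
  have hind := (iIndepFun_pi (μ := fun _ : ι => μ) (X := fun _ => id)
    fun _ => aemeasurable_id).indepFun hij
  have h : (Measure.pi fun _ : ι => μ).map (fun x => (x i, x j)) = _ :=
    (indepFun_iff_map_prod_eq_prod_map_map (measurable_pi_apply i).aemeasurable
    (measurable_pi_apply j).aemeasurable).1 hind
  rw [h]
  have e : ∀ k : ι, (Measure.pi fun _ : ι => μ).map (fun x => x k) = μ :=
    fun k => (measurePreserving_eval (fun _ : ι => μ) k).map_eq
  exact congrArg₂ _ (e i) (e j)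

/-- If `W` vanishes almost everywhere on `R`, then almost surely no edge of the random graph joins
two vertices whose types form a pair in `R`. -/
theorem ae_forall_not_adj (W : Graphon Ω) (μ : Measure Ω) [IsProbabilityMeasure μ] {R : Set (Ω × Ω)}
    (hR : ∀ᵐ p ∂(μ.prod μ), p ∈ R → W p.1 p.2 = 0) (n : ℕ) :
    ∀ᵐ x ∂(Measure.pi fun _ : Fin n => μ), ∀ᵐ G ∂(W.edgeLaw x),
      ∀ i j, G.Adj i j → (x i, x j) ∉ R := by
  have h : ∀ᵐ x ∂(Measure.pi fun _ : Fin n => μ), ∀ i j : Fin n, i ≠ j →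
      (x i, x j) ∈ R → W (x i) (x j) = 0 := by
    simp only [ae_all_iff]
    intro i j hij
    exact (measurePreserving_eval_pair μ hij).quasiMeasurePreserving.ae hR
  filter_upwards [h] with x hx
  simp only [ae_all_iff]
  intro i j
  by_cases hij : i = j
  · simp [hij]
  by_cases hxR : (x i, x j) ∈ R
  · have := W.edgeLaw_real_adj x hij
    rw [hx i j hij hxR] at this
    simp only [hxR, not_true_eq_false, imp_false]
    rw [ae_iff]
    simpa [measureReal_eq_zero_iff] using this
  · simp [hxR]

/-! ### Chernoff bounds for counts of sample points. -/

theorem integral_exp_indicator_sub (μ : Measure Ω) [IsProbabilityMeasure μ] {A C : Set Ω}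
    (hA : MeasurableSet A) (hC : MeasurableSet C) (hAC : Disjoint A C) (t : ℝ) :
    ∫ ω, Real.exp (t * (C.indicator 1 ω - A.indicator 1 ω)) ∂μ =
      1 - μ.real A * (1 - Real.exp (-t)) + μ.real C * (Real.exp t - 1) := by
  have h : ∀ ω, Real.exp (t * (C.indicator (1 : Ω → ℝ) ω - A.indicator 1 ω)) =
      1 + A.indicator 1 ω * (Real.exp (-t) - 1) + C.indicator 1 ω * (Real.exp t - 1) := by
    intro ω
    by_cases h1 : ω ∈ A
    · simp [h1, Set.disjoint_left.1 hAC h1]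
    · by_cases h2 : ω ∈ C <;> simp [h1, h2]
  have iA : Integrable (A.indicator (1 : Ω → ℝ)) μ := (integrable_const 1).indicator hA
  have iC : Integrable (C.indicator (1 : Ω → ℝ)) μ := (integrable_const 1).indicator hC
  simp_rw [h]
  have iA' : Integrable (fun ω => 1 + A.indicator (1 : Ω → ℝ) ω * (Real.exp (-t) - 1)) μ :=
    (integrable_const 1).add (iA.mul_const _)
  rw [integral_add iA' (iC.mul_const _),
    integral_add (integrable_const _) (iA.mul_const _), integral_mul_const, integral_mul_const,
    integral_indicator_one hA, integral_indicator_one hC]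
  simp only [integral_const, probReal_univ, smul_eq_mul]
  ring

/-- The exponential Markov inequality for comparing the numbers of sample points in two disjoint
sets. -/
theorem measureReal_sum_indicator_le (μ : Measure Ω) [IsProbabilityMeasure μ] {A C : Set Ω}
    (hA : MeasurableSet A) (hC : MeasurableSet C) (hAC : Disjoint A C) {t : ℝ} (ht : 0 ≤ t)
    (L : ℝ) (n : ℕ) :
    (Measure.pi fun _ : Fin n => μ).real
        {x | ∑ i, A.indicator (1 : Ω → ℝ) (x i) ≤ ∑ i, C.indicator (1 : Ω → ℝ) (x i) + L} ≤
      Real.exp (t * L) *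
        (1 - μ.real A * (1 - Real.exp (-t)) + μ.real C * (Real.exp t - 1)) ^ n := by
  set f : Ω → ℝ := fun ω => Real.exp (t * (C.indicator 1 ω - A.indicator 1 ω)) with hf
  have mA : Measurable (A.indicator (1 : Ω → ℝ)) := measurable_one.indicator hA
  have mC : Measurable (C.indicator (1 : Ω → ℝ)) := measurable_one.indicator hC
  have mB : MeasurableSet {x : Fin n → Ω |
      ∑ i, A.indicator (1 : Ω → ℝ) (x i) ≤ ∑ i, C.indicator (1 : Ω → ℝ) (x i) + L} :=
    measurableSet_le (by fun_prop) (by fun_prop)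
  have mf : Measurable f := by fun_prop
  have fi : Integrable f μ := by
    refine Integrable.of_bound mf.aestronglyMeasurable (Real.exp t) (ae_of_all _ fun ω => ?_)
    rw [Real.norm_of_nonneg (Real.exp_pos _).le]
    refine Real.exp_le_exp.2 (mul_le_of_le_one_right ht ?_)
    have h1 : C.indicator (1 : Ω → ℝ) ω ≤ 1 := Set.indicator_le_self' (by simp) ω
    have h2 : 0 ≤ A.indicator (1 : Ω → ℝ) ω := Set.indicator_nonneg (by simp) ω
    linarith
  have hpow := integral_fintype_prod_eq_pow (ι := Fin n) (μ := μ) f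
  rw [Fintype.card_fin] at hpow
  rw [← integral_exp_indicator_sub μ hA hC hAC t, ← hpow, ← integral_const_mul,
    ← integral_indicator_one mB]
  · refine integral_mono ((integrable_const 1).indicator mB)
      ((Integrable.fintype_prod fun _ => fi).const_mul _) fun x => ?_
    have hpos : 0 ≤ Real.exp (t * L) * ∏ i, f (x i) := by positivity
    refine Set.indicator_apply_le' (fun hx => ?_) fun _ => hpos
    rw [hf, ← Real.exp_sum, ← Real.exp_add, ← Finset.mul_sum, Finset.sum_sub_distrib, ← mul_add]
    refine Real.one_le_exp (mul_nonneg ht ?_)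
    rw [Set.mem_ofPred_eq] at hx
    linarith

theorem tendsto_measureReal_sum_indicator_le (μ : Measure Ω) [IsProbabilityMeasure μ] {A C : Set Ω}
    (hA : MeasurableSet A) (hC : MeasurableSet C) (hAC : Disjoint A C) (h : μ.real C < μ.real A) :
    Tendsto (fun n : ℕ => (Measure.pi fun _ : Fin n => μ).real
      {x | ∑ i, A.indicator (1 : Ω → ℝ) (x i) ≤ ∑ i, C.indicator (1 : Ω → ℝ) (x i)})
      atTop (𝓝 0) := by
  -- The moment is `r = 1 - (exp t - 1) * (μ A * exp (-t) - μ C)`, so it is below one as soon as `t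
  -- > 0` is small enough to keep the last factor positive.
  obtain ⟨t, ht, ht0⟩ : ∃ t : ℝ, μ.real C < μ.real A * Real.exp (-t) ∧ 0 < t := by
    have hc : Tendsto (fun t : ℝ => μ.real A * Real.exp (-t)) (𝓝[>] 0) (𝓝 (μ.real A)) := by
      have : Continuous fun t : ℝ => μ.real A * Real.exp (-t) := by fun_prop
      simpa using (this.tendsto 0).mono_left nhdsWithin_le_nhds
    exact ((hc.eventually_const_lt h).and self_mem_nhdsWithin).exists
  set r := 1 - μ.real A * (1 - Real.exp (-t)) + μ.real C * (Real.exp t - 1) with hr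
  have he : Real.exp (-t) * Real.exp t = 1 := by rw [← Real.exp_add]; simp
  have h1 : 1 < Real.exp t := Real.one_lt_exp_iff.2 ht0
  have hr1 : r < 1 := by
    have : r = 1 - (Real.exp t - 1) * (μ.real A * Real.exp (-t) - μ.real C) := by
      rw [hr]; linear_combination μ.real A * he
    rw [this]
    have := mul_pos (sub_pos.2 h1) (sub_pos.2 ht)
    linarith
  have hr0 : 0 ≤ r := by
    rw [hr, ← integral_exp_indicator_sub μ hA hC hAC t]
    exact integral_nonneg fun _ => (Real.exp_pos _).le
  refine squeeze_zero (fun _ => measureReal_nonneg) (fun n => ?_)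
    (tendsto_pow_atTop_nhds_zero_of_lt_one hr0 hr1)
  simpa using measureReal_sum_indicator_le μ hA hC hAC ht0.le 0 n

omit [MeasurableSpace Ω] in
theorem sum_indicator_eq_card {n : ℕ} (x : Fin n → Ω) (A : Set Ω) [DecidablePred (· ∈ A)] :
    ∑ i, A.indicator (1 : Ω → ℝ) (x i) = (Finset.univ.filter fun i => x i ∈ A).card := by
  simp [Set.indicator_apply, Finset.sum_boole]

/-! ### Obstructions (i), (iii) and (iv). -/

theorem tendsto_of_not_connected (μ : Measure Ω) [IsProbabilityMeasure μ] (W : Graphon Ω)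
    (hW : ¬ W.Connected μ) :
    Tendsto (fun n : ℕ => (W.randomGraph μ n).real {G | G.IsHamiltonian}) atTop (𝓝 0) := by
  classical
  simp only [Connected, not_forall] at hW
  obtain ⟨S, T, hS, hT, hST, hun, hS0, hT0, h0⟩ := hW
  have hzero : ∀ᵐ p ∂(μ.prod μ), p ∈ S ×ˢ T → W p.1 p.2 = 0 := by
    have hint : Integrable (fun p : Ω × Ω => (W p.1 p.2 : ℝ)) ((μ.prod μ).restrict (S ×ˢ T)) :=
      Integrable.of_bound W.measurable_coe_uncurry.aestronglyMeasurable 1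
        (ae_of_all _ fun p => by
          rw [Real.norm_of_nonneg (W p.1 p.2).2.1]; exact (W p.1 p.2).2.2)
    have hnn : 0 ≤ fun p : Ω × Ω => (W p.1 p.2 : ℝ) := fun p => (W p.1 p.2).2.1
    have := (integral_eq_zero_iff_of_nonneg hnn hint).1
      (le_antisymm (not_lt.1 h0) (integral_nonneg hnn))
    filter_upwards [(ae_restrict_iff' (hS.prod hT)).1 this] with p hp hpm
    exact Subtype.ext (hp hpm)
  -- Comparison with the empty set: the event is that no sampled type lies in `S`.
  have hSlim := tendsto_measureReal_sum_indicator_le μ hS MeasurableSet.empty (by simp)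
    (by rw [measureReal_empty]; exact ENNReal.toReal_pos hS0.ne' (measure_ne_top _ _))
  have hTlim := tendsto_measureReal_sum_indicator_le μ hT MeasurableSet.empty (by simp)
    (by rw [measureReal_empty]; exact ENNReal.toReal_pos hT0.ne' (measure_ne_top _ _))
  have mind : ∀ {A : Set Ω}, MeasurableSet A → Measurable (A.indicator (1 : Ω → ℝ)) :=
    fun hA => measurable_one.indicator hA
  refine squeeze_zero (fun _ => measureReal_nonneg) (fun n => ?_)
    (by simpa using hSlim.add hTlim)
  refine le_trans ?_ (measureReal_union_le _ _)
  refine W.randomGraph_real_le μ ?_ ?_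
  · have m1 := mind hS
    have m2 := mind hT
    exact (measurableSet_le (by fun_prop) (by fun_prop)).union
      (measurableSet_le (by fun_prop) (by fun_prop))
  filter_upwards [W.ae_forall_not_adj μ hzero n] with x hx
  filter_upwards [hx] with G hG hH
  replace hH : G.IsHamiltonian := hH
  have hex : ∀ A : Set Ω, x ∉ {x : Fin n → Ω | ∑ i, A.indicator (1 : Ω → ℝ) (x i) ≤ 0} →
      ∃ i, x i ∈ A := by
    intro A hA
    by_contra! hcon
    refine hA ?_
    rw [Set.mem_ofPred_eq]
    simp [hcon]
  by_contra hcon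
  rw [Set.mem_union, not_or] at hcon
  obtain ⟨i, hi⟩ := hex S hcon.1
  obtain ⟨j, hj⟩ := hex T hcon.2
  obtain ⟨p⟩ := hH.connected.preconnected i j
  obtain ⟨d, -, h1, h2⟩ := p.exists_boundary_dart {k | x k ∈ S} hi
    (Set.disjoint_right.1 hST hj)
  have : x d.snd ∈ S ∪ T := hun ▸ Set.mem_univ _
  exact hG _ _ d.adj ⟨h1, this.resolve_left h2⟩

theorem tendsto_of_hasNarrowPeninsula (μ : Measure Ω) [IsProbabilityMeasure μ] (W : Graphon Ω)
    (hW : W.HasNarrowPeninsula μ) :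
    Tendsto (fun n : ℕ => (W.randomGraph μ n).real {G | G.IsHamiltonian}) atTop (𝓝 0) := by
  classical
  obtain ⟨a, -, -, A, B, hA, hB, hAB, ha, hBa, hzero⟩ := hW
  set C := (A ∪ B)ᶜ with hC
  have mC : MeasurableSet C := (hA.union hB).compl
  have hAC : Disjoint A C := Set.disjoint_left.2 fun ω h1 h2 => h2 (Or.inl h1)
  have hlt : μ.real C < μ.real A := by
    rw [hC, probReal_compl_eq_one_sub (hA.union hB), measureReal_union hAB hB]
    linarith
  refine squeeze_zero' (.of_forall fun _ => measureReal_nonneg) ?_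
    (tendsto_measureReal_sum_indicator_le μ hA mC hAC hlt)
  -- A graph on one vertex is Hamiltonian by convention, without having a cycle.
  filter_upwards [eventually_ne_atTop 1] with n hn
  have m1 : Measurable (A.indicator (1 : Ω → ℝ)) := measurable_one.indicator hA
  have m2 : Measurable (C.indicator (1 : Ω → ℝ)) := measurable_one.indicator mC
  refine W.randomGraph_real_le μ (measurableSet_le (by fun_prop) (by fun_prop)) ?_
  filter_upwards [W.ae_forall_not_adj μ hzero n] with x hx
  filter_upwards [hx] with G hG hH
  simp only [sum_indicator_eq_card, Nat.cast_le]
  exact hH.card_filter_le (by simpa using hn) _ _ fun u v huv hu hv => hG u v huv ⟨hu, hv⟩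

theorem tendsto_of_isHalvedBipartite (μ : Measure Ω) [IsProbabilityMeasure μ] (W : Graphon Ω)
    (hW : W.IsHalvedBipartite μ) :
    Tendsto (fun n : ℕ => (W.randomGraph μ n).real {G | G.IsHamiltonian}) atTop (𝓝 0) := by
  classical
  obtain ⟨S, T, hS, hT, hST, hun, hSm, hTm, hzero⟩ := hW
  refine squeeze_zero' (.of_forall fun _ => measureReal_nonneg) ?_
    tendsto_choose_half_div_two_pow
  filter_upwards [eventually_ne_atTop 1] with n hn
  have hTS : ∀ ω, ω ∉ S ↔ ω ∈ T := fun ω => by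
    have h1 : ω ∈ S ∪ T := hun ▸ Set.mem_univ _
    exact ⟨h1.resolve_left, fun h => Set.disjoint_right.1 hST h⟩
  have mbox : ∀ s : Finset (Fin n),
      MeasurableSet (Set.univ.pi fun i => if i ∈ s then S else T) := fun s =>
    MeasurableSet.univ_pi fun i => by split_ifs <;> assumption
  -- The event is split according to the set `s` of indices with type in `S`; each box has
  -- probability `2⁻ⁿ`.
  have hsub : (W.randomGraph μ n).real {G | G.IsHamiltonian} ≤
      (Measure.pi fun _ : Fin n => μ).real
        (⋃ s ∈ (Finset.univ : Finset (Finset (Fin n))).filter (fun s => 2 * s.card = n),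
          Set.univ.pi fun i => if i ∈ s then S else T) := by
    refine W.randomGraph_real_le μ (Finset.measurableSet_biUnion _ fun s _ => mbox s) ?_
    filter_upwards [W.ae_forall_not_adj μ hzero n] with x hx
    filter_upwards [hx] with G hG hH
    have h1 := hH.card_filter_le (by simpa using hn) (fun i => x i ∈ S) (fun i => ¬ x i ∈ S)
      fun u v huv hu hv => hG u v huv (Or.inl ⟨hu, hv⟩)
    have h2 := hH.card_filter_le (by simpa using hn) (fun i => ¬ x i ∈ S) (fun i => x i ∈ S)
      fun u v huv hu => by
        by_contra hv
        exact hG u v huv (Or.inr ⟨(hTS _).1 hu, (hTS _).1 hv⟩)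
    have h3 := Finset.card_filter_add_card_filter_not (s := Finset.univ) (fun i => x i ∈ S)
    simp only [Finset.card_univ, Fintype.card_fin] at h3
    simp only [Set.mem_iUnion]
    refine ⟨Finset.univ.filter fun i => x i ∈ S, by simp; omega, fun i _ => ?_⟩
    by_cases hi : x i ∈ S
    · simp [hi]
    · simpa [hi] using (hTS _).1 hi
  refine hsub.trans ((measureReal_biUnion_finset_le _ _).trans (le_of_eq ?_))
  have hval : ∀ s : Finset (Fin n), (Measure.pi fun _ : Fin n => μ).real
      (Set.univ.pi fun i => if i ∈ s then S else T) = 1 / 2 ^ n := by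
    intro s
    rw [measureReal_def, Measure.pi_pi, ENNReal.toReal_prod]
    have : ∀ i, (μ (if i ∈ s then S else T)).toReal = 1 / 2 := fun i => by
      split_ifs <;> assumption
    simp [this]
  rw [Finset.sum_congr rfl fun s _ => hval s, Finset.sum_const, nsmul_eq_mul]
  split_ifs with he
  · have : (Finset.univ : Finset (Finset (Fin n))).filter (fun s => 2 * s.card = n) =
        Finset.powersetCard (n / 2) Finset.univ := by
      ext s
      have := Nat.even_iff.1 he
      simp only [Finset.mem_filter, Finset.mem_univ, true_and, Finset.mem_powersetCard,
        Finset.subset_univ]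
      omega
    rw [this, Finset.card_powersetCard, Finset.card_univ, Fintype.card_fin, mul_one_div]
  · rw [Finset.filter_false_of_mem, Finset.card_empty, Nat.cast_zero, zero_mul]
    exact fun s _ hs => he (hs ▸ even_two_mul s.card)

/-! ### Obstruction (ii): many points of low degree. -/

theorem integrable_indicator_mul (W : Graphon Ω) (ν : Measure (Ω × Ω)) [IsFiniteMeasure ν]
    {D : Set Ω} (hD : MeasurableSet D) :
    Integrable (fun p : Ω × Ω => D.indicator 1 p.1 * (W p.1 p.2 : ℝ)) ν := by
  have m1 : Measurable (D.indicator (1 : Ω → ℝ)) := measurable_one.indicator hD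
  have m2 := W.measurable_coe_uncurry
  refine Integrable.of_bound (by fun_prop) 1 (ae_of_all _ fun p => ?_)
  have h0 : 0 ≤ D.indicator (1 : Ω → ℝ) p.1 := Set.indicator_nonneg (by simp) _
  have h1 : D.indicator (1 : Ω → ℝ) p.1 ≤ 1 := Set.indicator_le_self' (by simp) _
  rw [Real.norm_of_nonneg (mul_nonneg h0 (W p.1 p.2).2.1)]
  exact mul_le_one₀ h1 (W p.1 p.2).2.1 (W p.1 p.2).2.2

theorem measurable_degree (W : Graphon Ω) (μ : Measure Ω) [SFinite μ] :
    Measurable (W.degree μ) :=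
  (W.measurable_coe_uncurry.stronglyMeasurable.integral_prod_right (ν := μ)).measurable

theorem measurableSet_lowDegree (W : Graphon Ω) (μ : Measure Ω) [SFinite μ] (α : ℝ) :
    MeasurableSet (W.lowDegree μ α) :=
  measurableSet_le (W.measurable_degree μ) measurable_const

/-- By Fubini the inner integral is the degree, which is at most `α` on the set. -/
theorem integral_indicator_lowDegree_mul_le (W : Graphon Ω) (μ : Measure Ω)
    [IsProbabilityMeasure μ] (α : ℝ) :
    ∫ p : Ω × Ω, (W.lowDegree μ α).indicator 1 p.1 * (W p.1 p.2 : ℝ) ∂(μ.prod μ) ≤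
      μ.real (W.lowDegree μ α) * α := by
  have hD := W.measurableSet_lowDegree μ α
  have hi := W.integrable_indicator_mul (μ.prod μ) hD
  rw [integral_prod _ hi, ← integral_indicator_one hD, ← integral_mul_const]
  refine integral_mono hi.integral_prod_left
    (((integrable_const 1).indicator hD).mul_const _) fun ω => ?_
  simp only [integral_const_mul]
  by_cases hω : ω ∈ W.lowDegree μ α
  · have hdeg : ∫ y, (W ω y : ℝ) ∂μ ≤ α := hω
    simpa [Set.indicator_of_mem hω] using hdeg
  · simp [hω]

/-- Given the vertex types, if at least `L` vertices have their type in `D`, then the probability of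
being Hamiltonian is at most `1 / L` times the expected number of ordered edges leaving these
vertices, since each of them has a neighbour. -/
theorem mul_edgeLaw_real_isHamiltonian_le (W : Graphon Ω) {n : ℕ} (hn : 1 < n) (x : Fin n → Ω)
    (D : Set Ω) {L : ℝ} (hL : L ≤ ∑ i, D.indicator (1 : Ω → ℝ) (x i)) :
    L * (W.edgeLaw x).real {G | G.IsHamiltonian} ≤
      ∑ i, ∑ j ∈ Finset.univ.erase i, D.indicator 1 (x i) * (W (x i) (x j) : ℝ) := by
  refine (mul_le_mul_of_nonneg_right hL measureReal_nonneg).trans ?_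
  rw [Finset.sum_mul]
  refine Finset.sum_le_sum fun i _ => ?_
  rw [← Finset.mul_sum]
  refine mul_le_mul_of_nonneg_left ?_ (Set.indicator_nonneg (by simp) _)
  calc (W.edgeLaw x).real {G | G.IsHamiltonian}
      ≤ (W.edgeLaw x).real (⋃ j ∈ Finset.univ.erase i, {G | G.Adj i j}) := by
        refine measureReal_mono (fun G hG => ?_) (measure_ne_top _ _)
        obtain ⟨j, hj⟩ := SimpleGraph.IsHamiltonian.exists_adj hG (by simpa using hn) i
        simp only [Set.mem_iUnion]
        exact ⟨j, by simpa using hj.ne', hj⟩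
    _ ≤ ∑ j ∈ Finset.univ.erase i, (W.edgeLaw x).real {G | G.Adj i j} :=
        measureReal_biUnion_finset_le _ _
    _ = _ := Finset.sum_congr rfl fun j hj => W.edgeLaw_real_adj x (Finset.ne_of_mem_erase hj).symm

/-- The first term bounds the probability of too few low-degree types. The second is the expected
number of ordered edges leaving them, at most `n² * m * α`, divided by `L = n * m / 2`. -/
theorem randomGraph_real_isHamiltonian_le (W : Graphon Ω) (μ : Measure Ω) [IsProbabilityMeasure μ]
    {n : ℕ} (hn : 1 < n) {α : ℝ} (hα : 0 ≤ α) (hm : 0 < μ.real (W.lowDegree μ α)) :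
    (W.randomGraph μ n).real {G | G.IsHamiltonian} ≤
      Real.exp (-((1 / 2 - Real.exp (-1)) * (n * μ.real (W.lowDegree μ α)))) + 2 * (n * α) := by
  set D := W.lowDegree μ α with hDdef
  set m := μ.real D with hmdef
  have hD : MeasurableSet D := W.measurableSet_lowDegree μ α
  have m1 : Measurable (D.indicator (1 : Ω → ℝ)) := measurable_one.indicator hD
  have hn0 : (0 : ℝ) < n := by exact_mod_cast (zero_lt_one.trans hn)
  set L : ℝ := n * m / 2 with hLdef
  have hL : 0 < L := by positivity
  set P := Measure.pi fun _ : Fin n => μ with hP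
  set E := {x : Fin n → Ω | ∑ i, D.indicator (1 : Ω → ℝ) (x i) ≤
    ∑ i, (∅ : Set Ω).indicator (1 : Ω → ℝ) (x i) + L} with hE
  have mE : MeasurableSet E := by
    simp only [hE, Set.indicator_empty]
    exact measurableSet_le (by fun_prop) (by fun_prop)
  have hpair : ∀ i j : Fin n, i ≠ j →
      Integrable (fun x : Fin n → Ω => D.indicator 1 (x i) * (W (x i) (x j) : ℝ)) P ∧
      ∫ x, D.indicator 1 (x i) * (W (x i) (x j) : ℝ) ∂P ≤ m * α := by
    intro i j hij
    have hmp := measurePreserving_eval_pair (ι := Fin n) μ hij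
    have hi := W.integrable_indicator_mul (μ.prod μ) hD
    refine ⟨hmp.integrable_comp_of_integrable hi, ?_⟩
    refine le_trans (le_of_eq ?_) (W.integral_indicator_lowDegree_mul_le μ α)
    rw [← hmp.map_eq, integral_map hmp.measurable.aemeasurable]
    rw [hmp.map_eq]
    exact hi.aestronglyMeasurable
  have hint : Integrable (fun x : Fin n → Ω =>
      ∑ i, ∑ j ∈ Finset.univ.erase i, D.indicator 1 (x i) * (W (x i) (x j) : ℝ)) P :=
    integrable_finsetSum _ fun i _ => integrable_finsetSum _ fun j hj =>
      (hpair i j (Finset.ne_of_mem_erase hj).symm).1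
  have hbound : ∀ x, (W.edgeLaw x).real {G | G.IsHamiltonian} ≤ E.indicator 1 x + L⁻¹ *
      ∑ i, ∑ j ∈ Finset.univ.erase i, D.indicator 1 (x i) * (W (x i) (x j) : ℝ) := by
    intro x
    by_cases hx : x ∈ E
    · have h0 : 0 ≤ L⁻¹ * ∑ i, ∑ j ∈ Finset.univ.erase i,
          D.indicator 1 (x i) * (W (x i) (x j) : ℝ) :=
        mul_nonneg (inv_nonneg.2 hL.le) (Finset.sum_nonneg fun i _ => Finset.sum_nonneg fun j _ =>
          mul_nonneg (Set.indicator_nonneg (by simp) _) (W (x i) (x j)).2.1)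
      have h1 : (W.edgeLaw x).real {G | G.IsHamiltonian} ≤ 1 := measureReal_le_one
      simp only [Set.indicator_of_mem hx, Pi.one_apply]
      linarith
    · rw [Set.indicator_of_notMem hx, zero_add, ← div_eq_inv_mul, le_div_iff₀' hL]
      refine W.mul_edgeLaw_real_isHamiltonian_le hn x D ?_
      simp only [hE, Set.mem_ofPred_eq, not_le, Set.indicator_empty, Finset.sum_const_zero,
        zero_add] at hx
      exact hx.le
  have hsum : ∫ x, ∑ i, ∑ j ∈ Finset.univ.erase i, D.indicator 1 (x i) * (W (x i) (x j) : ℝ) ∂P ≤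
      n * (n * (m * α)) := by
    rw [integral_finsetSum _ fun i _ => integrable_finsetSum _ fun j hj =>
      (hpair i j (Finset.ne_of_mem_erase hj).symm).1]
    calc _ ≤ ∑ i : Fin n, (n * (m * α) : ℝ) := Finset.sum_le_sum fun i _ => by
          rw [integral_finsetSum _ fun j hj => (hpair i j (Finset.ne_of_mem_erase hj).symm).1]
          calc _ ≤ ∑ j ∈ Finset.univ.erase i, m * α :=
                Finset.sum_le_sum fun j hj => (hpair i j (Finset.ne_of_mem_erase hj).symm).2
            _ ≤ ∑ j : Fin n, m * α := Finset.sum_le_sum_of_subset_of_nonneg (Finset.erase_subset _ _)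
                fun _ _ _ => by positivity
            _ = _ := by simp
      _ = _ := by simp
  -- Chernoff with `t = 1`: the exponent is `n * m / 2 - n * m * (1 - exp (-1))`.
  have hE' : P.real E ≤ Real.exp (-((1 / 2 - Real.exp (-1)) * (n * m))) := by
    refine (measureReal_sum_indicator_le μ hD MeasurableSet.empty (by simp) zero_le_one L n).trans ?_
    have hm1 : m ≤ 1 := measureReal_le_one
    have he : Real.exp (-1) ≤ 1 := Real.exp_le_one_iff.2 (by norm_num)
    have h0 : 0 ≤ 1 - m * (1 - Real.exp (-1)) := by
      nlinarith [Real.exp_pos (-1)]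
    have h1 : 1 - m * (1 - Real.exp (-1)) ≤ Real.exp (-(m * (1 - Real.exp (-1)))) := by
      have := Real.add_one_le_exp (-(m * (1 - Real.exp (-1))))
      linarith
    simp only [measureReal_empty, zero_mul, add_zero, one_mul]
    calc _ ≤ Real.exp L * Real.exp (-(m * (1 - Real.exp (-1)))) ^ n := by gcongr
      _ = _ := by
        rw [← Real.exp_nat_mul, ← Real.exp_add]
        congr 1
        rw [hLdef]
        ring
  have hi1 : Integrable (E.indicator (1 : (Fin n → Ω) → ℝ)) P := (integrable_const 1).indicator mE
  have hmeas : Measurable fun x : Fin n → Ω => (W.edgeLaw x).real {G | G.IsHamiltonian} :=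
    ((Measure.measurable_coe (measurableSet_graphs _)).comp (W.measurable_edgeLaw n)).ennreal_toReal
  rw [randomGraph_real_eq_integral]
  calc _ ≤ ∫ x, (E.indicator 1 x + L⁻¹ * ∑ i, ∑ j ∈ Finset.univ.erase i,
          D.indicator 1 (x i) * (W (x i) (x j) : ℝ)) ∂P :=
        integral_mono (Integrable.of_bound hmeas.aestronglyMeasurable 1 (ae_of_all _ fun x => by
          rw [Real.norm_of_nonneg measureReal_nonneg]; exact measureReal_le_one))
          (hi1.add (hint.const_mul _)) hbound
    _ = P.real E + L⁻¹ * ∫ x, ∑ i, ∑ j ∈ Finset.univ.erase i,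
          D.indicator 1 (x i) * (W (x i) (x j) : ℝ) ∂P := by
        rw [integral_add hi1 (hint.const_mul _), integral_indicator_one mE, integral_const_mul]
    _ ≤ Real.exp (-((1 / 2 - Real.exp (-1)) * (n * m))) + L⁻¹ * (n * (n * (m * α))) := by gcongr
    _ = _ := by
        congr 1
        rw [hLdef]
        field_simp

theorem tendsto_of_lowDegree (μ : Measure Ω) [IsProbabilityMeasure μ] (W : Graphon Ω)
    (hW : Tendsto (fun α : ℝ => μ.real (W.lowDegree μ α) / α) (𝓝[>] 0) atTop) :
    Tendsto (fun n : ℕ => (W.randomGraph μ n).real {G | G.IsHamiltonian}) atTop (𝓝 0) := by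
  refine tendsto_order.2 ⟨fun a ha => .of_forall fun n => ha.trans_le measureReal_nonneg,
    fun ε hε => ?_⟩
  -- With `α = c / n` the term `2 * (n * α)` equals `ε / 2`, leaving `ε / 2` for the exponential.
  set c := ε / 4 with hc
  have hc0 : 0 < c := by positivity
  have hα : Tendsto (fun n : ℕ => c / (n : ℝ)) atTop (𝓝[>] 0) := by
    refine tendsto_nhdsWithin_iff.2 ⟨tendsto_const_div_atTop_nhds_zero_nat c, ?_⟩
    filter_upwards [eventually_gt_atTop 0] with n hn
    exact div_pos hc0 (by exact_mod_cast hn)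
  have hdiv : Tendsto (fun n : ℕ => (n : ℝ) * μ.real (W.lowDegree μ (c / n))) atTop atTop := by
    refine ((hW.comp hα).const_mul_atTop hc0).congr' ?_
    filter_upwards [eventually_gt_atTop 0] with n hn
    have : (n : ℝ) ≠ 0 := by exact_mod_cast hn.ne'
    simp only [Function.comp_apply]
    field_simp
  have hκ : 0 < 1 / 2 - Real.exp (-1) := by
    have : 2 < Real.exp 1 := lt_trans (by norm_num) Real.exp_one_gt_d9
    rw [Real.exp_neg, ← one_div, sub_pos]
    exact one_div_lt_one_div_of_lt two_pos this
  have hexp : Tendsto (fun n : ℕ => Real.exp (-((1 / 2 - Real.exp (-1)) *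
      (n * μ.real (W.lowDegree μ (c / n)))))) atTop (𝓝 0) :=
    Real.tendsto_exp_neg_atTop_nhds_zero.comp (hdiv.const_mul_atTop hκ)
  filter_upwards [hexp.eventually_lt_const (half_pos hε), hdiv.eventually_gt_atTop 0,
    eventually_gt_atTop 1] with n h1 h2 h3
  have hn : (0 : ℝ) < n := by exact_mod_cast (zero_lt_one.trans h3)
  have h := W.randomGraph_real_isHamiltonian_le μ h3 (div_nonneg hc0.le hn.le)
    (pos_of_mul_pos_right h2 hn.le)
  rw [mul_div_cancel₀ _ hn.ne'] at h
  linarith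

end Graphon

theorem proposition6p1 {Ω : Type*} [MeasurableSpace Ω] [StandardBorelSpace Ω]
    (μ : Measure Ω) [IsProbabilityMeasure μ] [NullSingletonClass μ] (W : Graphon Ω)
    (hW : ¬ W.Connected μ ∨
      Tendsto (fun α : ℝ => μ.real (W.lowDegree μ α) / α) (𝓝[>] 0) atTop ∨
      W.HasNarrowPeninsula μ ∨
      W.IsHalvedBipartite μ) :
    Tendsto (fun n : ℕ => (W.randomGraph μ n).real {G | G.IsHamiltonian}) atTop (𝓝 0) := by
  rcases hW with h | h | h | h
  · exact W.tendsto_of_not_connected μ h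
  · exact W.tendsto_of_lowDegree μ h
  · exact W.tendsto_of_hasNarrowPeninsula μ h
  · exact W.tendsto_of_isHalvedBipartite μ h
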